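/- Let $K$ be an imaginary quadratic field with a fixed embedding $K\subset\mathbb{C}$, let $\mathfrak m\subset\mathcal O_K$ be a nonzero ideal and let $k\ge 1$ be an integer. Let $I_{\mathfrak m}$ be the group of fractional ideals of $K$ coprime to $\mathfrak m$, and let $\varrho\colon I_{\mathfrak m}\to\mathbb{C}^\times$ be an algebraic Hecke character of weight $k$, i.e. a homomorphism such that $$\varrho(\alpha\mathcal O_K)=\alpha^{k-1}\quad\text{for all }\alpha\in K^\times\text{ with }\alpha\mathcal O_K\in I_{\mathfrak m}\text{ and }\alpha\equiv 1 \bmod \mathfrak m$$ ($\mathfrak m$ is not required to be the largest such ideal). Let $\mathbb{Q}(\varrho)\subset\mathbb{C}$ be the field generated over $\mathbb{Q}$ by the values of $\varrho$. Let $$\vartheta_\varrho=\sum_{\mathfrak a}\varrho(\mathfrak a)\,q^{\mathrm{Nm}(\mathfrak a)},$$ where the sum runs over the nonzero integral ideals $\mathfrak a$ of $\mathcal O_K$ and $\varrho(\mathfrak a)=0$ if $\mathfrak a$ is not coprime to $\mathfrak m$, and let $F_\varrho\subset\mathbb{Q}(\varrho)$ be the field generated over $\mathbb{Q}$ by the Fourier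 coefficients of $\vartheta_\varrho$, i.e. the coefficients of this $q$-series. Then: 1. The extension $\mathbb{Q}(\varrho)/F_\varrho$ is a finite Galois extension, and its Galois group is an elementary abelian $2$-group, i.e. it is abelian and each of its elements has order dividing $2$ (it may be trivial). 2. The field $\mathbb{Q}(\varrho)$ is a number field and is Kroneckerian, i.e. it is totally real or a CM field. -/

import Mathlib

open NumberField
open scoped nonZeroDivisors

noncomputable section

namespace CMTheta

variable {K : Type*} [Field K] [NumberField K]

/-- The group `I_𝔪` of fractional ideals of `K` that are coprime to the modulus `𝔪`: no prime
dividing `𝔪` occurs in the factorization. -/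
def coprimeIdeals (𝔪 : Ideal (𝓞 K)) : Subgroup (FractionalIdeal (𝓞 K)⁰ K)ˣ where
  carrier := {I | ∀ v : IsDedekindDomain.HeightOneSpectrum (𝓞 K), v.asIdeal ∣ 𝔪 →
    FractionalIdeal.count K v (I : FractionalIdeal (𝓞 K)⁰ K) = 0}
  one_mem' := fun v _ => by
    rw [Units.val_one, FractionalIdeal.count_one]
  mul_mem' := fun {I J} hI hJ v hv => by
    rw [Units.val_mul, FractionalIdeal.count_mul K v I.ne_zero J.ne_zero, hI v hv, hJ v hv,
      add_zero]
  inv_mem' := fun {I} hI v hv => by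
    rw [Units.val_inv_eq_inv_val, FractionalIdeal.count_inv, hI v hv, neg_zero]

/-- The congruence `α ≡ 1 mod 𝔪` for a nonzero element `α` of `K`, not necessarily integral:
`α = a / b` with `a, b` integral, `b` coprime to `𝔪` and `a ≡ b mod 𝔪`. -/
def CongrOne (𝔪 : Ideal (𝓞 K)) (α : Kˣ) : Prop :=
  ∃ a b : 𝓞 K, IsCoprime (Ideal.span {b}) 𝔪 ∧ a - b ∈ 𝔪 ∧ (α : K) * (b : K) = (a : K)

/-- Algebraic Hecke characters of weight `k` on the fractional ideals of `K` coprime to `𝔪`, where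
`K` is embedded in `ℂ` by `ι`: characters `ϱ` of `I_𝔪` with `ϱ(α 𝓞) = α ^ (k - 1)` for all
principal ideals `α 𝓞` in `I_𝔪` with `α ≡ 1 mod 𝔪`. -/
structure AlgebraicHeckeCharacter (ι : K →+* ℂ) (𝔪 : Ideal (𝓞 K)) (k : ℕ) where
  /-- the underlying character -/
  toHom : coprimeIdeals 𝔪 →* ℂˣ
  map_principal : ∀ (α : Kˣ) (h : toPrincipalIdeal (𝓞 K) K α ∈ coprimeIdeals 𝔪),
    CongrOne 𝔪 α → (toHom ⟨toPrincipalIdeal (𝓞 K) K α, h⟩ : ℂ) = ι (α : K) ^ (k - 1)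

namespace AlgebraicHeckeCharacter

variable {ι : K →+* ℂ} {𝔪 : Ideal (𝓞 K)} {k : ℕ} (ϱ : AlgebraicHeckeCharacter ι 𝔪 k)

/-- The field `ℚ(ϱ) ⊆ ℂ` generated by the values of `ϱ`. -/
def valueField : IntermediateField ℚ ℂ :=
  IntermediateField.adjoin ℚ (Set.range fun I : coprimeIdeals 𝔪 => (ϱ.toHom I : ℂ))

open Classical in
/-- The value `ϱ(𝔞)` at an integral ideal `𝔞`, with the usual convention that it is `0` if `𝔞` is
zero or not coprime to `𝔪`. -/
def onIdeal (𝔞 : Ideal (𝓞 K)) : ℂ :=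
  if h : ∃ h₀ : 𝔞 ∈ (Ideal (𝓞 K))⁰, FractionalIdeal.mk0 K ⟨𝔞, h₀⟩ ∈ coprimeIdeals 𝔪 then
    (ϱ.toHom ⟨FractionalIdeal.mk0 K ⟨𝔞, h.1⟩, h.2⟩ : ℂ)
  else 0

/-- The theta series `ϑ_ϱ = ∑ ϱ(𝔞) q ^ Nm(𝔞)`, the sum over the integral ideals `𝔞`, as a
`q`-series: its `n`-th Fourier coefficient is the sum of `ϱ(𝔞)` over the finitely many `𝔞` of
norm `n`. -/
def theta : PowerSeries ℂ :=
  PowerSeries.mk fun n =>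
    ∑ 𝔞 ∈ (Ideal.finite_setOfPred_absNorm_eq (S := 𝓞 K) n).toFinset, ϱ.onIdeal 𝔞

/-- The field `F_ϱ ⊆ ℂ` generated by the Fourier coefficients of `ϑ_ϱ`. -/
def coeffField : IntermediateField ℚ ℂ :=
  IntermediateField.adjoin ℚ (Set.range fun n : ℕ => PowerSeries.coeff n ϱ.theta)

theorem onIdeal_mem_valueField (𝔞 : Ideal (𝓞 K)) : ϱ.onIdeal 𝔞 ∈ ϱ.valueField := by
  unfold onIdeal
  split_ifs with h
  · exact IntermediateField.subset_adjoin ℚ _ ⟨_, rfl⟩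
  · exact zero_mem _

theorem coeffField_le_valueField : ϱ.coeffField ≤ ϱ.valueField := by
  refine IntermediateField.adjoin_le_iff.mpr ?_
  rintro _ ⟨n, rfl⟩
  simp only [theta, PowerSeries.coeff_mk]
  exact sum_mem fun 𝔞 _ => ϱ.onIdeal_mem_valueField 𝔞

/-- `ℚ(ϱ)` as an extension of `F_ϱ`. -/
abbrev valueFieldOver : IntermediateField ϱ.coeffField ℂ :=
  IntermediateField.extendScalars ϱ.coeffField_le_valueField

end AlgebraicHeckeCharacter

/-- An elementary abelian `2`-group: abelian, and every element has order dividing `2`. -/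
def IsElementaryAbelianTwoGroup (G : Type*) [Group G] : Prop :=
  (∀ g h : G, g * h = h * g) ∧ ∀ g : G, g ^ 2 = 1

/-- A number field is Kroneckerian if it is totally real or a CM field. -/
def IsKroneckerian (L : Type*) [Field L] [CharZero L] : Prop :=
  NumberField L ∧ (IsTotallyReal L ∨ IsCMField L)

end CMTheta

end

/-!
The ray class group mod `𝔪` is finite, so for every `I` in `I_𝔪` there are `n ≠ 0` and `α` with
`I ^ n = (α)` and `ϱ(I) ^ n = α ^ (k - 1)`. Hence `ℚ(ϱ)` is a number field, and since the norm of
`α` is `|ψ(α)| ^ 2` for both embeddings `ψ` of `K`, every embedding `φ` of `ℚ(ϱ)` satisfies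
`|φ(ϱ(I))| ^ 2 = Nm(I) ^ (k - 1)`. So the element `Nm(I) ^ (k - 1) / ϱ(I)` is the complex conjugate
of `ϱ(I)` under all embeddings at once, which forces `ℚ(ϱ)` to be totally real or CM.

The field `ℚ(ϱ)` is generated by the values `x = ϱ(𝔭)` at primes. If `𝔭` is the only ideal of its
norm, then `x` is a coefficient of `ϑ_ϱ`. Otherwise `𝔭` lies over a split prime `p = 𝔭𝔮`; with
`y = ϱ(𝔮)`, the coefficients at `p` and `p ^ 2` are `x + y` and `x ^ 2 + x * y + y ^ 2`, so `x` and
`y` are the roots of a quadratic polynomial over `F_ϱ`. An automorphism over `F_ϱ` fixes or swaps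
them, hence is an involution.
-/

namespace CMTheta

section CoprimeIdeals

variable {K : Type*} [Field K] [NumberField K] {𝔪 : Ideal (𝓞 K)}

theorem count_mk0_eq_zero_iff (v : IsDedekindDomain.HeightOneSpectrum (𝓞 K))
    (A : (Ideal (𝓞 K))⁰) :
    FractionalIdeal.count K v (FractionalIdeal.mk0 K A) = 0 ↔
      ¬ v.asIdeal ∣ (A : Ideal (𝓞 K)) := by
  classical
  have hA : (A : Ideal (𝓞 K)) ≠ 0 := nonZeroDivisors.coe_ne_zero A
  rw [FractionalIdeal.coe_mk0, FractionalIdeal.count_coe K v hA, Nat.cast_eq_zero,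
    ← Associates.count_ne_zero_iff_dvd hA v.irreducible, not_not]

theorem mk0_mem_coprimeIdeals_iff (A : (Ideal (𝓞 K))⁰) :
    FractionalIdeal.mk0 K A ∈ coprimeIdeals 𝔪 ↔ IsCoprime (A : Ideal (𝓞 K)) 𝔪 := by
  refine ⟨fun h => ?_, fun h v hv => (count_mk0_eq_zero_iff v A).mpr fun hvA =>
    v.prime.not_isUnit (h.isUnit_of_dvd' hvA hv)⟩
  rw [Ideal.isCoprime_iff_sup_eq]
  by_contra hne
  obtain ⟨M, hM, hle⟩ := Ideal.exists_le_maximal _ hne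
  have hAM : (A : Ideal (𝓞 K)) ≤ M := le_sup_left.trans hle
  have hM0 : M ≠ ⊥ := ne_bot_of_le_ne_bot (nonZeroDivisors.coe_ne_zero A) hAM
  exact (count_mk0_eq_zero_iff ⟨M, hM.isPrime, hM0⟩ A).mp
    (h _ (Ideal.dvd_iff_le.mpr (le_sup_right.trans hle))) (Ideal.dvd_iff_le.mpr hAM)

theorem exists_eq_mk0_div_mk0_isCoprime (I : (FractionalIdeal (𝓞 K)⁰ K)ˣ) :
    ∃ A B : (Ideal (𝓞 K))⁰, IsCoprime (A : Ideal (𝓞 K)) B ∧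
      I = FractionalIdeal.mk0 K A / FractionalIdeal.mk0 K B := by
  set N : Ideal (𝓞 K) := (I : FractionalIdeal (𝓞 K)⁰ K).num
  set D : Ideal (𝓞 K) := Ideal.span {((I : FractionalIdeal (𝓞 K)⁰ K).den : 𝓞 K)}
  have hD : D ≠ 0 := mt Ideal.span_singleton_eq_bot.mp (nonZeroDivisors.coe_ne_zero _)
  have hIN : (D : FractionalIdeal (𝓞 K)⁰ K) * I = N := by
    rw [FractionalIdeal.coeIdeal_span_singleton, FractionalIdeal.den_mul_self_eq_num']
  have hN : N ≠ 0 := (FractionalIdeal.num_eq_zero_iff).not.mpr I.ne_zero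
  obtain ⟨A, B, hNA, hDB, hAB⟩ := extract_gcd N D
  set G : Ideal (𝓞 K) := gcd N D
  have hG : G ≠ 0 := fun h => hN (by rw [hNA, h, zero_mul])
  have hA : A ≠ 0 := fun h => hN (by rw [hNA, h, mul_zero])
  have hB : B ≠ 0 := fun h => hD (by rw [hDB, h, mul_zero])
  refine ⟨⟨A, mem_nonZeroDivisors_of_ne_zero hA⟩, ⟨B, mem_nonZeroDivisors_of_ne_zero hB⟩,
    Ideal.isCoprime_iff_sup_eq.mpr (Ideal.isUnit_iff.mp hAB), ?_⟩
  rw [eq_div_iff_mul_eq', ← Units.val_inj]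
  refine mul_left_cancel₀ (FractionalIdeal.coeIdeal_ne_zero.mpr hG) ?_
  calc (G : FractionalIdeal (𝓞 K)⁰ K) * (I * B)
      = (G * B : Ideal (𝓞 K)) * I := by rw [FractionalIdeal.coeIdeal_mul]; ring
    _ = (G * A : Ideal (𝓞 K)) := by rw [← hDB, hIN, ← hNA]
    _ = G * A := FractionalIdeal.coeIdeal_mul _ _

theorem exists_eq_mk0_div_mk0_of_mem_coprimeIdeals {I : (FractionalIdeal (𝓞 K)⁰ K)ˣ}
    (hI : I ∈ coprimeIdeals 𝔪) :
    ∃ A B : (Ideal (𝓞 K))⁰, FractionalIdeal.mk0 K A ∈ coprimeIdeals 𝔪 ∧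
      FractionalIdeal.mk0 K B ∈ coprimeIdeals 𝔪 ∧
      I = FractionalIdeal.mk0 K A / FractionalIdeal.mk0 K B := by
  obtain ⟨A, B, hAB, rfl⟩ := exists_eq_mk0_div_mk0_isCoprime I
  suffices hB : FractionalIdeal.mk0 K B ∈ coprimeIdeals 𝔪 from
    ⟨A, B, (div_mul_cancel (FractionalIdeal.mk0 K A) _) ▸ mul_mem hI hB, hB, rfl⟩
  intro v hv
  by_cases hvB : v.asIdeal ∣ (B : Ideal (𝓞 K))
  · have hA := (count_mk0_eq_zero_iff v A).mpr fun hvA =>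
      v.prime.not_isUnit (hAB.isUnit_of_dvd' hvA hvB)
    have hdiv := hI v hv
    rwa [div_eq_mul_inv, Units.val_mul, Units.val_inv_eq_inv_val,
      FractionalIdeal.count_mul K v (Units.ne_zero _) (inv_ne_zero (Units.ne_zero _)),
      FractionalIdeal.count_inv, hA, zero_add, neg_eq_zero] at hdiv
  · exact (count_mk0_eq_zero_iff v B).mpr hvB

end CoprimeIdeals

section RayClassGroup

theorem relIndex_ne_zero_of_finite {G β : Type*} [Group G] [Finite β]
    {H L : Subgroup G} (f : L → β) (hf : ∀ x y, f x = f y → (x : G)⁻¹ * y ∈ H) :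
    H.relIndex L ≠ 0 := by
  have hinj : Function.Injective fun q : L ⧸ H.subgroupOf L => f q.out := fun q r h => by
    rw [← q.out_eq', ← r.out_eq']
    exact QuotientGroup.eq.mpr (hf _ _ h)
  have := Finite.of_injective _ hinj
  exact Subgroup.index_ne_zero_of_finite

variable {K : Type*} [Field K] [NumberField K] {𝔪 : Ideal (𝓞 K)}

variable (𝔪) in
/-- The ray `K_{𝔪,1}`: the group of the `α : Kˣ` with `α ≡ 1 mod 𝔪`, without any condition at the
infinite places. -/
def ray : Subgroup Kˣ where
  carrier := {α | CongrOne 𝔪 α}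
  one_mem' := ⟨1, 1, by simp [Ideal.isCoprime_iff_sup_eq], by simp, by simp⟩
  mul_mem' := by
    rintro α β ⟨a, b, hb, hab, h⟩ ⟨c, d, hd, hcd, h'⟩
    refine ⟨a * c, b * d, ?_, ?_, ?_⟩
    · rw [← Ideal.span_singleton_mul_span_singleton]
      exact hb.mul_left hd
    · have : a * c - b * d = (a - b) * c + b * (c - d) := by ring
      exact this ▸ add_mem (𝔪.mul_mem_right c hab) (𝔪.mul_mem_left b hcd)
    · change (α * β : K) * (b * d) = a * c
      rw [← h, ← h']
      ring
  inv_mem' := by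
    rintro α ⟨a, b, hb, hab, h⟩
    refine ⟨b, a, ?_, ?_, ?_⟩
    · rw [Ideal.isCoprime_iff_sup_eq, eq_top_iff, ← Ideal.isCoprime_iff_sup_eq.mp hb, sup_le_iff,
        Ideal.span_singleton_le_iff_mem]
      refine ⟨?_, le_sup_right⟩
      rw [← sub_sub_cancel a b]
      exact sub_mem (Ideal.mem_sup_left (Ideal.mem_span_singleton_self a))
        (Ideal.mem_sup_right hab)
    · rw [← neg_sub]
      exact neg_mem hab
    · rw [← h, Units.val_inv_eq_inv_val, inv_mul_cancel_left₀ α.ne_zero]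

theorem exists_mul_eq_of_toPrincipalIdeal_mem_coprimeIdeals {α : Kˣ}
    (hα : toPrincipalIdeal (𝓞 K) K α ∈ coprimeIdeals 𝔪) :
    ∃ a b : 𝓞 K, IsCoprime (Ideal.span {a}) 𝔪 ∧ IsCoprime (Ideal.span {b}) 𝔪 ∧
      (α : K) * b = a := by
  classical
  obtain ⟨A, B, hA, hB, hAB⟩ := exists_eq_mk0_div_mk0_of_mem_coprimeIdeals hα
  rw [mk0_mem_coprimeIdeals_iff] at hA hB
  set h := Fintype.card (ClassGroup (𝓞 K))
  obtain ⟨b, hb⟩ : ∃ b : 𝓞 K, (B : Ideal (𝓞 K)) ^ h = Ideal.span {b} := by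
    have : (ClassGroup.mk0 B) ^ h = 1 := pow_card_eq_one
    rw [← map_pow] at this
    exact ((ClassGroup.mk0_eq_one_iff (B ^ h).2).mp this).principal
  have hαb : FractionalIdeal.spanSingleton (𝓞 K)⁰ (α * b : K) =
      ((A * B ^ (h - 1) : Ideal (𝓞 K)) : FractionalIdeal (𝓞 K)⁰ K) := by
    rw [← FractionalIdeal.spanSingleton_mul_spanSingleton, ← coe_toPrincipalIdeal, hAB,
      ← FractionalIdeal.coeIdeal_span_singleton, ← hb, ← mul_pow_sub_one Fintype.card_ne_zero,
      FractionalIdeal.coeIdeal_mul, FractionalIdeal.coeIdeal_mul, ← mul_assoc,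
      Units.val_div_eq_div_val, FractionalIdeal.coe_mk0, FractionalIdeal.coe_mk0,
      div_mul_cancel₀ _ (FractionalIdeal.coeIdeal_ne_zero.mpr (nonZeroDivisors.coe_ne_zero B))]
  obtain ⟨a, -, ha⟩ : ∃ a ∈ (A * B ^ (h - 1) : Ideal (𝓞 K)), (a : K) = α * b :=
    (FractionalIdeal.mem_coeIdeal _).mp (hαb ▸ FractionalIdeal.mem_spanSingleton_self _ _)
  refine ⟨a, b, ?_, hb ▸ hB.pow_left, ha.symm⟩
  rw [← ha] at hαb
  have := FractionalIdeal.coeIdeal_injective (K := K)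
    ((FractionalIdeal.coeIdeal_span_singleton a).trans hαb)
  rw [this]
  exact hA.mul_left hB.pow_left

theorem ray_relIndex_ne_zero (h𝔪 : 𝔪 ≠ ⊥) :
    (ray 𝔪).relIndex ((coprimeIdeals 𝔪).comap (toPrincipalIdeal (𝓞 K) K)) ≠ 0 := by
  have : Finite (𝓞 K ⧸ 𝔪) := Ideal.finiteQuotientOfFreeOfNeBot 𝔪 h𝔪
  choose a b ha hb hab using
    fun α : (coprimeIdeals 𝔪).comap (toPrincipalIdeal (𝓞 K) K) =>
      exists_mul_eq_of_toPrincipalIdeal_mem_coprimeIdeals α.2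
  refine relIndex_ne_zero_of_finite
    (fun α => (Ideal.Quotient.mk 𝔪 (a α), Ideal.Quotient.mk 𝔪 (b α))) fun α β h => ?_
  obtain ⟨h₁, h₂⟩ := Prod.mk.inj h
  refine ⟨b α * a β, a α * b β, ?_, ?_, ?_⟩
  · rw [← Ideal.span_singleton_mul_span_singleton]
    exact (ha α).mul_left (hb β)
  · rw [← Ideal.Quotient.eq, map_mul, map_mul, h₁, h₂, mul_comm]
  · change (((α : Kˣ)⁻¹ * β : Kˣ) : K) * (a α * b β) = b α * a β
    rw [← hab α, ← hab β, Units.val_mul, Units.val_inv_eq_inv_val]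
    field_simp

variable (𝔪) in
/-- The principal ideals generated by elements of the ray mod `𝔪`. The quotient of `I_𝔪` by this
group is the ray class group mod `𝔪`. -/
noncomputable def rayIdeals : Subgroup (FractionalIdeal (𝓞 K)⁰ K)ˣ :=
  (ray 𝔪).map (toPrincipalIdeal (𝓞 K) K)

theorem rayIdeals_relIndex_ne_zero (h𝔪 : 𝔪 ≠ ⊥) :
    (rayIdeals 𝔪).relIndex (coprimeIdeals 𝔪) ≠ 0 := by
  have hray : (rayIdeals 𝔪).relIndex
      ((toPrincipalIdeal (𝓞 K) K).range ⊓ coprimeIdeals 𝔪) ≠ 0 := by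
    rw [← Subgroup.map_comap_eq, rayIdeals, Subgroup.relIndex_map_map,
      sup_eq_left.mpr (Subgroup.ker_le_comap _ _)]
    exact ne_zero_of_dvd_ne_zero (ray_relIndex_ne_zero h𝔪)
      (Subgroup.relIndex_dvd_of_le_left _ le_sup_left)
  have hprincipal : ((toPrincipalIdeal (𝓞 K) K).range ⊓ coprimeIdeals 𝔪).relIndex
      (coprimeIdeals 𝔪) ≠ 0 := by
    have : Finite ((FractionalIdeal (𝓞 K)⁰ K)ˣ ⧸ (toPrincipalIdeal (𝓞 K) K).range) :=
      Finite.of_equiv _ (ClassGroup.equiv K).toEquiv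
    rw [Subgroup.inf_relIndex_right]
    exact ne_zero_of_dvd_ne_zero Subgroup.index_ne_zero_of_finite
      (Subgroup.relIndex_dvd_index_of_normal _ _)
  exact Subgroup.relIndex_ne_zero_trans hray hprincipal

end RayClassGroup

namespace AlgebraicHeckeCharacter

section Values

variable {K : Type*} [Field K] [NumberField K] {ι : K →+* ℂ} {𝔪 : Ideal (𝓞 K)} {k : ℕ}
  (ϱ : AlgebraicHeckeCharacter ι 𝔪 k)

theorem exists_toHom_eq_pow_of_mem_rayIdeals {I : coprimeIdeals 𝔪}
    (hI : (I : (FractionalIdeal (𝓞 K)⁰ K)ˣ) ∈ rayIdeals 𝔪) :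
    ∃ α : Kˣ, toPrincipalIdeal (𝓞 K) K α = I ∧ (ϱ.toHom I : ℂ) = ι α ^ (k - 1) := by
  obtain ⟨I, hIm⟩ := I
  obtain ⟨α, hα, rfl⟩ := hI
  exact ⟨α, rfl, ϱ.map_principal α hIm hα⟩

theorem exists_toHom_pow_eq_pow (h𝔪 : 𝔪 ≠ ⊥) (I : coprimeIdeals 𝔪) :
    ∃ n ≠ 0, ∃ α : Kˣ, toPrincipalIdeal (𝓞 K) K α = (I : (FractionalIdeal (𝓞 K)⁰ K)ˣ) ^ n ∧
      (ϱ.toHom I : ℂ) ^ n = ι α ^ (k - 1) := by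
  obtain ⟨n, hn, -, hIn⟩ :=
    Subgroup.exists_pow_mem_of_relIndex_ne_zero (rayIdeals_relIndex_ne_zero h𝔪) I.2
  obtain ⟨α, hα, h⟩ := ϱ.exists_toHom_eq_pow_of_mem_rayIdeals (I := I ^ n) hIn.1
  exact ⟨n, hn.ne', α, hα, by rw [← h, map_pow, Units.val_pow_eq_pow_val]⟩

theorem isIntegral_toHom (h𝔪 : 𝔪 ≠ ⊥) (I : coprimeIdeals 𝔪) :
    IsIntegral ℚ (ϱ.toHom I : ℂ) := by
  obtain ⟨n, hn, α, -, hα⟩ := ϱ.exists_toHom_pow_eq_pow h𝔪 I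
  refine IsIntegral.of_pow (Nat.pos_of_ne_zero hn) (hα ▸ IsIntegral.pow ?_ _)
  exact (Algebra.IsIntegral.isIntegral (R := ℚ) (α : K)).map (RingHom.toRatAlgHom ι)

theorem numberField_valueField (h𝔪 : 𝔪 ≠ ⊥) : NumberField ϱ.valueField := by
  let H := (rayIdeals 𝔪).subgroupOf (coprimeIdeals 𝔪)
  have : H.FiniteIndex := ⟨rayIdeals_relIndex_ne_zero h𝔪⟩
  have : Finite (coprimeIdeals 𝔪 ⧸ H) := Subgroup.finite_quotient_of_finiteIndex
  let E : IntermediateField ℚ ℂ := (RingHom.toRatAlgHom ι).fieldRange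
  let S : Set ℂ := Set.range fun q : coprimeIdeals 𝔪 ⧸ H => (ϱ.toHom q.out : ℂ)
  have : FiniteDimensional ℚ E :=
    LinearMap.finiteDimensional_range (RingHom.toRatAlgHom ι).toLinearMap
  have : FiniteDimensional ℚ (IntermediateField.adjoin ℚ S) :=
    IntermediateField.finiteDimensional_adjoin
      (Set.forall_mem_range.mpr fun q => ϱ.isIntegral_toHom h𝔪 q.out)
  have hle : ϱ.valueField ≤ E ⊔ IntermediateField.adjoin ℚ S := by
    refine IntermediateField.adjoin_le_iff.mpr (Set.range_subset_iff.mpr fun I => ?_)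
    obtain ⟨R, hR⟩ := QuotientGroup.mk_out_eq_mul H I
    obtain ⟨α, -, hα⟩ := ϱ.exists_toHom_eq_pow_of_mem_rayIdeals R.2
    have hI : (ϱ.toHom I : ℂ) = ϱ.toHom (I : coprimeIdeals 𝔪 ⧸ H).out / ι α ^ (k - 1) := by
      rw [hR, map_mul, Units.val_mul, hα, mul_div_cancel_right₀ _ (hα ▸ Units.ne_zero _)]
    have hS : (ϱ.toHom (I : coprimeIdeals 𝔪 ⧸ H).out : ℂ) ∈ IntermediateField.adjoin ℚ S :=
      IntermediateField.subset_adjoin ℚ S ⟨_, rfl⟩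
    have hE : ι α ∈ E := ⟨α, rfl⟩
    rw [SetLike.mem_coe, hI]
    exact div_mem ((le_sup_right : _ ≤ E ⊔ _) hS) (pow_mem ((le_sup_left : E ≤ _) hE) _)
  have : FiniteDimensional ℚ ϱ.valueField :=
    FiniteDimensional.of_injective (IntermediateField.inclusion hle).toLinearMap
      (IntermediateField.inclusion_injective hle)
  exact ⟨⟩

end Values

end AlgebraicHeckeCharacter

section Kroneckerian

open scoped ComplexConjugate

theorem exists_algHom_apply_eq_of_apply_eq {F K L Ω Ω' : Type*} [Field F] [Field K] [Field L]
    [Field Ω] [Field Ω'] [Algebra F K] [Algebra F L] [Algebra F Ω] [Algebra F Ω']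
    [Algebra.IsAlgebraic F K] [IsAlgClosed Ω'] (ι : K →ₐ[F] Ω) (j : L →ₐ[F] Ω) (φ : L →ₐ[F] Ω')
    {x : K} {y : L} (h : ι x = j y) : ∃ ψ : K →ₐ[F] Ω', ψ x = φ y := by
  have hmin : minpoly F x = minpoly F (φ y) := by
    rw [← minpoly.algHom_eq ι ι.injective, h, minpoly.algHom_eq j j.injective,
      minpoly.algHom_eq φ φ.injective]
  have hroot : φ y ∈ (minpoly F x).rootSet Ω' := by
    rw [Polynomial.mem_rootSet, hmin]
    exact ⟨hmin ▸ minpoly.ne_zero (Algebra.IsIntegral.isIntegral x), minpoly.aeval F _⟩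
  rwa [← Algebra.IsAlgebraic.range_eval_eq_rootSet_minpoly] at hroot

theorem isCMField_of_forall_isConj {L : Type*} [Field L] [NumberField L] {σ : L ≃ₐ[ℚ] L}
    (hσ : ∀ φ : L →+* ℂ, ComplexEmbedding.IsConj φ σ) (hσ1 : σ ≠ 1) : IsCMField L := by
  have φ₀ : L →+* ℂ := Classical.arbitrary _
  let F := IntermediateField.fixedField (Subgroup.zpowers σ)
  have : IsTotallyComplex L := ⟨fun w => by
    rw [← InfinitePlace.mk_embedding w, InfinitePlace.isComplex_mk_iff]
    exact (ComplexEmbedding.isConj_ne_one_iff (hσ w.embedding)).mp hσ1⟩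
  have : IsTotallyReal F := ⟨fun w => by
    obtain ⟨W, rfl⟩ := w.comap_surjective (K := L)
    beta_reduce
    rw [← InfinitePlace.mk_embedding W, InfinitePlace.comap_mk, InfinitePlace.isReal_mk_iff,
      ComplexEmbedding.isReal_iff]
    ext x
    have hx : σ x = x := x.2 ⟨σ, Subgroup.mem_zpowers σ⟩
    exact (RingHom.congr_fun (hσ W.embedding) x).trans (congrArg W.embedding hx)⟩
  have : Algebra.IsQuadraticExtension F L := ⟨by
    rw [IntermediateField.finrank_fixedField_eq_card, Nat.card_zpowers,
      ComplexEmbedding.orderOf_isConj_two_of_ne_one (hσ φ₀) hσ1]⟩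
  exact IsCMField.ofCMExtension F L

theorem isKroneckerian_of_forall_exists_conj {L : Type*} [Field L] [NumberField L]
    (h : ∀ x : L, ∃ y : L, ∀ φ : L →+* ℂ, φ y = conj (φ x)) : IsKroneckerian L := by
  choose τ hτ using h
  have φ₀ : L →+* ℂ := Classical.arbitrary _
  have hττ : ∀ x, τ (τ x) = x := fun x => φ₀.injective (by rw [hτ, hτ, Complex.conj_conj])
  let σ : L ≃ₐ[ℚ] L := AlgEquiv.ofRingEquiv (f :=
    { toFun := τ
      invFun := τ
      left_inv := hττ
      right_inv := hττ
      map_mul' := fun x y => φ₀.injective (by simp only [hτ, map_mul])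
      map_add' := fun x y => φ₀.injective (by simp only [hτ, map_add]) })
    fun q => φ₀.injective (by simp)
  have hσ : ∀ φ : L →+* ℂ, ComplexEmbedding.IsConj φ σ := fun φ =>
    RingHom.ext fun x => (hτ x φ).symm
  refine ⟨inferInstance, ?_⟩
  by_cases hσ1 : σ = 1
  · refine .inl ⟨fun w => ?_⟩
    rw [← InfinitePlace.mk_embedding w, InfinitePlace.isReal_mk_iff,
      ← ComplexEmbedding.isConj_one_iff (k := ℚ), ← hσ1]
    exact hσ _
  · exact .inr (isCMField_of_forall_isConj hσ hσ1)

theorem norm_sq_eq_abs_norm {K : Type*} [Field K] [NumberField K]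
    (hquad : Module.finrank ℚ K = 2) [IsTotallyComplex K] (φ : K →+* ℂ) (x : K) :
    ‖φ x‖ ^ 2 = |Algebra.norm ℚ x| := by
  have hcard : Fintype.card (InfinitePlace K) = 1 := by
    have := IsTotallyComplex.finrank K
    rw [InfinitePlace.card_eq_nrRealPlaces_add_nrComplexPlaces,
      IsTotallyComplex.nrRealPlaces_eq_zero]
    omega
  have := Fintype.card_le_one_iff_subsingleton.mp hcard.le
  have hprod := InfinitePlace.prod_eq_abs_norm x
  rwa [Fintype.prod_subsingleton _ (InfinitePlace.mk φ), IsTotallyComplex.mult_eq,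
    InfinitePlace.apply] at hprod

end Kroneckerian

namespace AlgebraicHeckeCharacter

section ComplexConjugation

open scoped ComplexConjugate

variable {K : Type*} [Field K] [NumberField K] {ι : K →+* ℂ} {𝔪 : Ideal (𝓞 K)} {k : ℕ}
  (ϱ : AlgebraicHeckeCharacter ι 𝔪 k)

/-- The character `ϱ` with its values regarded as elements of the field `ℚ(ϱ)`, so that the
embeddings of that field can be applied to them. -/
noncomputable def valueHom : coprimeIdeals 𝔪 →* ϱ.valueField :=
  ((Units.coeHom ℂ).comp ϱ.toHom).codRestrict ϱ.valueField
    fun I => IntermediateField.subset_adjoin ℚ _ ⟨I, rfl⟩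

theorem norm_sq_map_valueHom (hquad : Module.finrank ℚ K = 2) [IsTotallyComplex K] (h𝔪 : 𝔪 ≠ ⊥)
    (φ : ϱ.valueField →+* ℂ) (I : coprimeIdeals 𝔪) :
    ‖φ (ϱ.valueHom I)‖ ^ 2 = (FractionalIdeal.absNorm I.1.val : ℝ) ^ (k - 1) := by
  obtain ⟨n, hn, α, hα, h⟩ := ϱ.exists_toHom_pow_eq_pow h𝔪 I
  obtain ⟨ψ, hψ⟩ : ∃ ψ : K →ₐ[ℚ] ℂ, ψ (α ^ (k - 1)) = φ (ϱ.valueHom I ^ n) :=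
    exists_algHom_apply_eq_of_apply_eq (RingHom.toRatAlgHom ι) ϱ.valueField.val
      (RingHom.toRatAlgHom φ) ((map_pow ι _ _).trans h.symm)
  have hN : |Algebra.norm ℚ (α : K)| = FractionalIdeal.absNorm I.1.val ^ n := by
    rw [← FractionalIdeal.absNorm_span_singleton (𝓞 K), ← coe_toPrincipalIdeal, hα,
      Units.val_pow_eq_pow_val, map_pow]
  refine (pow_left_inj₀ (by positivity) (pow_nonneg ?_ _) hn).mp ?_
  · exact_mod_cast FractionalIdeal.absNorm_nonneg _
  · calc (‖φ (ϱ.valueHom I)‖ ^ 2) ^ n = (‖ψ (α : K)‖ ^ 2) ^ (k - 1) := by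
          rw [pow_right_comm, ← norm_pow, ← map_pow, ← hψ, map_pow, norm_pow, pow_right_comm]
      _ = ((|Algebra.norm ℚ (α : K)| : ℚ) : ℝ) ^ (k - 1) := by
          rw [← norm_sq_eq_abs_norm hquad ψ.toRingHom]; rfl
      _ = ((FractionalIdeal.absNorm I.1.val : ℝ) ^ (k - 1)) ^ n := by
          rw [hN, Rat.cast_pow, pow_right_comm]

theorem map_div_valueHom_eq_conj (hquad : Module.finrank ℚ K = 2) [IsTotallyComplex K]
    (h𝔪 : 𝔪 ≠ ⊥) (φ : ϱ.valueField →+* ℂ) (I : coprimeIdeals 𝔪) :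
    φ ((FractionalIdeal.absNorm I.1.val : ϱ.valueField) ^ (k - 1) / ϱ.valueHom I) =
      conj (φ (ϱ.valueHom I)) := by
  have hne : φ (ϱ.valueHom I) ≠ 0 :=
    (map_ne_zero φ).mpr fun h => (ϱ.toHom I).ne_zero (congrArg Subtype.val h)
  rw [map_div₀, map_pow, map_ratCast, div_eq_iff hne, Complex.conj_mul']
  exact_mod_cast (ϱ.norm_sq_map_valueHom hquad h𝔪 φ I).symm

theorem isKroneckerian_valueField (hquad : Module.finrank ℚ K = 2) [IsTotallyComplex K]
    (h𝔪 : 𝔪 ≠ ⊥) : IsKroneckerian ϱ.valueField := by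
  have := ϱ.numberField_valueField h𝔪
  refine isKroneckerian_of_forall_exists_conj fun x => ?_
  obtain ⟨x, hx⟩ := x
  induction hx using IntermediateField.adjoin_induction with
  | mem x hx =>
    obtain ⟨I, rfl⟩ := hx
    exact ⟨_, fun φ => ϱ.map_div_valueHom_eq_conj hquad h𝔪 φ I⟩
  | algebraMap q =>
    exact ⟨algebraMap ℚ _ q, fun φ => RingHom.congr_fun (RingHom.ext_rat
      (φ.comp (algebraMap ℚ _)) (((starRingEnd ℂ).comp φ).comp (algebraMap ℚ _))) q⟩
  | add x y hx hy ihx ihy =>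
    obtain ⟨x', hx'⟩ := ihx
    obtain ⟨y', hy'⟩ := ihy
    exact ⟨x' + y', fun φ => by rw [map_add, hx', hy', ← map_add, ← map_add]; rfl⟩
  | inv x hx ihx =>
    obtain ⟨x', hx'⟩ := ihx
    exact ⟨x'⁻¹, fun φ => by rw [map_inv₀, hx', ← map_inv₀, ← map_inv₀]; rfl⟩
  | mul x y hx hy ihx ihy =>
    obtain ⟨x', hx'⟩ := ihx
    obtain ⟨y', hy'⟩ := ihy
    exact ⟨x' * y', fun φ => by rw [map_mul, hx', hy', ← map_mul, ← map_mul]; rfl⟩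

end ComplexConjugation

end AlgebraicHeckeCharacter

section QuadraticGenerators

open Polynomial

theorem isIntegral_of_add_of_mul {F E : Type*} [CommRing F] [CommRing E] [Algebra F E] {x y : E}
    {s t : F} (hs : x + y = algebraMap F E s) (ht : x * y = algebraMap F E t) :
    IsIntegral F x := by
  refine ⟨X ^ 2 - C s * X + C t, by monicity!, ?_⟩
  simp only [eval₂_add, eval₂_sub, eval₂_mul, eval₂_pow, eval₂_X, eval₂_C, ← hs, ← ht]
  ring

theorem splits_minpoly_of_add_of_mul {F E : Type*} [Field F] [Field E] [Algebra F E] {x y : E}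
    {s t : F} (hs : x + y = algebraMap F E s) (ht : x * y = algebraMap F E t) :
    ((minpoly F x).map (algebraMap F E)).Splits := by
  have hfac : (X ^ 2 - C s * X + C t : F[X]).map (algebraMap F E) = (X - C x) * (X - C y) := by
    simp only [Polynomial.map_add, Polynomial.map_sub, Polynomial.map_mul, Polynomial.map_pow,
      map_X, map_C, ← hs, ← ht, C_add, C_mul]
    ring
  have hroot : aeval x (X ^ 2 - C s * X + C t : F[X]) = 0 := by
    rw [aeval_def, ← eval_map, hfac, eval_mul, eval_sub, eval_X, eval_C, sub_self, zero_mul]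
  have hdvd : (minpoly F x).map (algebraMap F E) ∣ (X - C x) * (X - C y) := by
    rw [← hfac]
    exact Polynomial.map_dvd _ (minpoly.dvd F x hroot)
  exact ((Splits.X_sub_C x).mul (Splits.X_sub_C y)).of_dvd
    (mul_ne_zero (X_sub_C_ne_zero x) (X_sub_C_ne_zero y)) hdvd

theorem apply_apply_eq_of_add_of_mul {R : Type*} [CommRing R] [IsDomain R] (g : R →+* R) {x y : R}
    (hadd : g (x + y) = x + y) (hmul : g (x * y) = x * y) : g (g x) = x := by
  rw [map_add] at hadd
  rw [map_mul] at hmul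
  have hroot : (g x - x) * (g x - y) = 0 := by linear_combination g x * hadd - hmul
  rcases mul_eq_zero.mp hroot with hx | hy
  · rw [sub_eq_zero.mp hx, sub_eq_zero.mp hx]
  · rw [sub_eq_zero.mp hy] at hadd ⊢
    linear_combination hadd

theorem isElementaryAbelianTwoGroup_of_forall_sq_eq_one {G : Type*} [Group G]
    (h : ∀ g : G, g ^ 2 = 1) : IsElementaryAbelianTwoGroup G :=
  ⟨fun g g' => Commute.of_orderOf_dvd_two (fun g => orderOf_dvd_iff_pow_eq_one.mpr (h g)) g g', h⟩

variable {F L : Type*} [Field F] [Field L] [Algebra F L] {E : IntermediateField F L} {S : Set L}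

theorem normal_of_eq_adjoin_of_forall_exists_add_mul (hE : E = IntermediateField.adjoin F S)
    (hS : ∀ x ∈ S, ∃ y ∈ E, ∃ s t : F, x + y = algebraMap F L s ∧ x * y = algebraMap F L t) :
    Normal F E := by
  have hgen : ∀ x ∈ S, IsIntegral F x ∧ ((minpoly F x).map (algebraMap F E)).Splits := by
    intro x hx
    obtain ⟨y, hy, s, t, hs, ht⟩ := hS x hx
    have hxE : x ∈ E := hE ▸ IntermediateField.subset_adjoin F S hx
    refine ⟨isIntegral_of_add_of_mul hs ht, ?_⟩
    rw [← IntermediateField.minpoly_eq (⟨x, hxE⟩ : E)]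
    exact splits_minpoly_of_add_of_mul (y := ⟨y, hy⟩) (Subtype.ext hs) (Subtype.ext ht)
  have halg : Algebra.IsAlgebraic F E :=
    hE ▸ IntermediateField.isAlgebraic_adjoin fun x hx => (hgen x hx).1
  refine normal_iff.mpr fun x => ⟨Algebra.IsIntegral.isIntegral x, ?_⟩
  rw [IntermediateField.minpoly_eq]
  exact IntermediateField.splits_of_mem_adjoin F L hgen (hE ▸ x.2)

theorem isElementaryAbelianTwoGroup_algEquiv_of_eq_adjoin
    (hE : E = IntermediateField.adjoin F S)
    (hS : ∀ x ∈ S, ∃ y ∈ E, ∃ s t : F, x + y = algebraMap F L s ∧ x * y = algebraMap F L t) :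
    IsElementaryAbelianTwoGroup (E ≃ₐ[F] E) := by
  refine isElementaryAbelianTwoGroup_of_forall_sq_eq_one fun g => ?_
  have hsq : ((g ^ 2 : E ≃ₐ[F] E) : E →ₐ[F] E) = AlgHom.id F E := by
    refine IntermediateField.algHom_ext_of_eq_adjoin F hE fun x hx => ?_
    obtain ⟨y, hy, s, t, hs, ht⟩ := hS x hx
    have hxE : x ∈ E := hE ▸ IntermediateField.subset_adjoin F S hx
    have hadd : (⟨x, hxE⟩ : E) + ⟨y, hy⟩ = algebraMap F E s := Subtype.ext hs
    have hmul : (⟨x, hxE⟩ : E) * ⟨y, hy⟩ = algebraMap F E t := Subtype.ext ht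
    exact apply_apply_eq_of_add_of_mul (g : E →+* E) (by rw [hadd]; exact g.commutes s)
      (by rw [hmul]; exact g.commutes t)
  exact AlgEquiv.ext fun x => DFunLike.congr_fun hsq x

end QuadraticGenerators

namespace AlgebraicHeckeCharacter

section OnIdeal

variable {K : Type*} [Field K] [NumberField K] {ι : K →+* ℂ} {𝔪 : Ideal (𝓞 K)} {k : ℕ}
  (ϱ : AlgebraicHeckeCharacter ι 𝔪 k)

theorem onIdeal_coe (A : (Ideal (𝓞 K))⁰) (h : FractionalIdeal.mk0 K A ∈ coprimeIdeals 𝔪) :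
    ϱ.onIdeal A = ϱ.toHom ⟨FractionalIdeal.mk0 K A, h⟩ :=
  dif_pos ⟨A.2, h⟩

theorem onIdeal_zero : ϱ.onIdeal 0 = 0 :=
  dif_neg fun h => nonZeroDivisors.ne_zero h.1 rfl

theorem onIdeal_of_not_isCoprime {A : Ideal (𝓞 K)} (hA : ¬ IsCoprime A 𝔪) : ϱ.onIdeal A = 0 :=
  dif_neg fun h => hA ((mk0_mem_coprimeIdeals_iff ⟨A, h.1⟩).mp h.2)

theorem onIdeal_one : ϱ.onIdeal 1 = 1 := by
  have hone : FractionalIdeal.mk0 K 1 ∈ coprimeIdeals 𝔪 := by rw [map_one]; exact one_mem _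
  have hval : (⟨FractionalIdeal.mk0 K 1, hone⟩ : coprimeIdeals 𝔪) = 1 :=
    Subtype.ext (map_one (FractionalIdeal.mk0 K))
  calc ϱ.onIdeal 1 = ϱ.toHom ⟨FractionalIdeal.mk0 K 1, hone⟩ := ϱ.onIdeal_coe 1 hone
    _ = 1 := by rw [hval, map_one, Units.val_one]

theorem onIdeal_mul (A B : Ideal (𝓞 K)) : ϱ.onIdeal (A * B) = ϱ.onIdeal A * ϱ.onIdeal B := by
  rcases eq_or_ne A 0 with rfl | hA
  · rw [zero_mul, onIdeal_zero, zero_mul]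
  rcases eq_or_ne B 0 with rfl | hB
  · rw [mul_zero, onIdeal_zero, mul_zero]
  by_cases hcop : IsCoprime A 𝔪 ∧ IsCoprime B 𝔪
  · lift A to (Ideal (𝓞 K))⁰ using mem_nonZeroDivisors_of_ne_zero hA
    lift B to (Ideal (𝓞 K))⁰ using mem_nonZeroDivisors_of_ne_zero hB
    have hAmem := (mk0_mem_coprimeIdeals_iff A).mpr hcop.1
    have hBmem := (mk0_mem_coprimeIdeals_iff B).mpr hcop.2
    have hmul : FractionalIdeal.mk0 K (A * B) ∈ coprimeIdeals 𝔪 := by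
      rw [map_mul]
      exact mul_mem hAmem hBmem
    have hval : (⟨FractionalIdeal.mk0 K (A * B), hmul⟩ : coprimeIdeals 𝔪) =
        ⟨FractionalIdeal.mk0 K A, hAmem⟩ * ⟨FractionalIdeal.mk0 K B, hBmem⟩ :=
      Subtype.ext (map_mul (FractionalIdeal.mk0 K) A B)
    rw [ϱ.onIdeal_coe A hAmem, ϱ.onIdeal_coe B hBmem, ← Units.val_mul, ← map_mul, ← hval]
    exact ϱ.onIdeal_coe (A * B) hmul
  · rw [ϱ.onIdeal_of_not_isCoprime (mt IsCoprime.mul_left_iff.mp hcop)]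
    rcases not_and_or.mp hcop with hcA | hcB
    · rw [ϱ.onIdeal_of_not_isCoprime hcA, zero_mul]
    · rw [ϱ.onIdeal_of_not_isCoprime hcB, mul_zero]

theorem onIdeal_pow (A : Ideal (𝓞 K)) (n : ℕ) : ϱ.onIdeal (A ^ n) = ϱ.onIdeal A ^ n := by
  induction n with
  | zero => rw [pow_zero, pow_zero, onIdeal_one]
  | succ n ih => rw [pow_succ, pow_succ, onIdeal_mul, ih]

theorem exists_toHom_eq_onIdeal_div_onIdeal (I : coprimeIdeals 𝔪) :
    ∃ A B : Ideal (𝓞 K), (ϱ.toHom I : ℂ) = ϱ.onIdeal A / ϱ.onIdeal B := by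
  obtain ⟨A, B, hA, hB, hI⟩ := exists_eq_mk0_div_mk0_of_mem_coprimeIdeals I.2
  refine ⟨A, B, ?_⟩
  rw [ϱ.onIdeal_coe A hA, ϱ.onIdeal_coe B hB, ← Units.val_div_eq_div_val, ← map_div]
  exact congrArg (fun J => (ϱ.toHom J : ℂ)) (Subtype.ext hI)

theorem onIdeal_mem_of_forall_prime (T : Subfield ℂ)
    (hT : ∀ P : Ideal (𝓞 K), Prime P → ϱ.onIdeal P ∈ T) (A : Ideal (𝓞 K)) :
    ϱ.onIdeal A ∈ T := by
  induction A using UniqueFactorizationMonoid.induction_on_prime with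
  | h₁ => rw [onIdeal_zero]; exact T.zero_mem
  | h₂ A hA => rw [Ideal.isUnit_iff.mp hA, ← Ideal.one_eq_top, onIdeal_one]; exact T.one_mem
  | h₃ A P _ hP ih => rw [onIdeal_mul]; exact T.mul_mem (hT P hP) ih

theorem valueField_le_of_forall_prime (T : IntermediateField ℚ ℂ)
    (hT : ∀ P : Ideal (𝓞 K), Prime P → ϱ.onIdeal P ∈ T) : ϱ.valueField ≤ T := by
  refine IntermediateField.adjoin_le_iff.mpr ?_
  rintro _ ⟨I, rfl⟩
  obtain ⟨A, B, hI⟩ := ϱ.exists_toHom_eq_onIdeal_div_onIdeal I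
  have hmem := ϱ.onIdeal_mem_of_forall_prime T.toSubfield hT
  exact (congrArg (· ∈ T) hI).mpr (T.div_mem (hmem A) (hmem B))

theorem valueFieldOver_eq_adjoin :
    ϱ.valueFieldOver = IntermediateField.adjoin ϱ.coeffField (ϱ.onIdeal '' {P | Prime P}) := by
  apply le_antisymm
  · intro x hx
    rw [IntermediateField.mem_extendScalars] at hx
    rw [← IntermediateField.mem_restrictScalars (K := ℚ)]
    refine ϱ.valueField_le_of_forall_prime _ (fun P hP => ?_) hx
    rw [IntermediateField.mem_restrictScalars]
    exact IntermediateField.subset_adjoin ϱ.coeffField _ (Set.mem_image_of_mem ϱ.onIdeal hP)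
  · rw [IntermediateField.adjoin_le_iff]
    rintro _ ⟨P, -, rfl⟩
    exact ϱ.onIdeal_mem_valueField P

end OnIdeal

end AlgebraicHeckeCharacter

section IdealsOfPrimePowerNorm

open Finset.HasAntidiagonal

theorem exponent_eq_of_pow_mul_pow_eq {M : Type*} [CommMonoidWithZero M] [IsCancelMulZero M]
    {P Q : M} (hP : Prime P) (hPQ : ¬ P ∣ Q) {i i' j j' : ℕ}
    (h : P ^ i * Q ^ j = P ^ i' * Q ^ j') : i = i' := by
  have hle : ∀ {a b c d : ℕ}, P ^ a * Q ^ b = P ^ c * Q ^ d → a ≤ c := fun {a b c d} heq =>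
    (pow_dvd_pow_iff hP.ne_zero hP.not_isUnit).mp <|
      hP.pow_dvd_of_dvd_mul_right a (mt hP.dvd_of_dvd_pow hPQ) (heq ▸ dvd_mul_right _ _)
  exact le_antisymm (hle h) (hle h.symm)

variable {K : Type*} [Field K] [NumberField K] {P Q I : Ideal (𝓞 K)} {p : ℕ}

theorem prime_of_absNorm_eq_prime (hp : p.Prime) (hP : Ideal.absNorm P = p) : Prime P :=
  (Ideal.irreducible_of_irreducible_absNorm
    (hP ▸ (Nat.irreducible_iff_nat_prime p).mpr hp)).prime

theorem absNorm_eq_pow_iff_of_mul_eq_span (hp : p.Prime)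
    (hPQ : P * Q = Ideal.span {(p : 𝓞 K)}) (hP : Ideal.absNorm P = p)
    (hQ : Ideal.absNorm Q = p) (n : ℕ) :
    Ideal.absNorm I = p ^ n ↔ ∃ e ∈ antidiagonal n, P ^ e.1 * Q ^ e.2 = I := by
  refine ⟨fun hI => ?_, ?_⟩
  · have hdvd : I ∣ P ^ n * Q ^ n := by
      rw [← mul_pow, hPQ, Ideal.span_singleton_pow, Ideal.dvd_span_singleton, ← Nat.cast_pow, ← hI]
      exact Ideal.absNorm_mem I
    obtain ⟨A, B, hA, hB, rfl⟩ := exists_dvd_and_dvd_of_dvd_mul hdvd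
    obtain ⟨i, -, hi⟩ := (dvd_prime_pow (prime_of_absNorm_eq_prime hp hP) n).mp hA
    obtain ⟨j, -, hj⟩ := (dvd_prime_pow (prime_of_absNorm_eq_prime hp hQ) n).mp hB
    obtain rfl := associated_iff_eq.mp hi
    obtain rfl := associated_iff_eq.mp hj
    rw [map_mul, map_pow, map_pow, hP, hQ, ← pow_add] at hI
    exact ⟨(i, j), mem_antidiagonal.mpr (Nat.pow_right_injective hp.two_le hI), rfl⟩
  · rintro ⟨e, he, rfl⟩
    rw [map_mul, map_pow, map_pow, hP, hQ, ← pow_add, mem_antidiagonal.mp he]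

theorem not_dvd_of_absNorm_eq_prime (hp : p.Prime) (hP : Ideal.absNorm P = p)
    (hQ : Ideal.absNorm Q = p) (hne : P ≠ Q) : ¬ P ∣ Q := fun hdvd =>
  hne <| associated_iff_eq.mp <|
    (prime_of_absNorm_eq_prime hp hP).associated_of_dvd (prime_of_absNorm_eq_prime hp hQ) hdvd

theorem eq_of_absNorm_eq_of_span_natCast_eq (hP : Prime P) (hp : Ideal.span {(p : 𝓞 K)} = P)
    (hI : Ideal.absNorm I = Ideal.absNorm P) : I = P := by
  have hnorm : Ideal.absNorm P = p ^ Module.finrank ℚ K := by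
    rw [← hp, Ideal.absNorm_span_natCast, RingOfIntegers.rank]
  have hdvd : I ∣ P ^ Module.finrank ℚ K := by
    rw [← hp, Ideal.span_singleton_pow, Ideal.dvd_span_singleton, ← Nat.cast_pow, ← hnorm, ← hI]
    exact Ideal.absNorm_mem I
  obtain ⟨j, -, hj⟩ := (dvd_prime_pow hP _).mp hdvd
  obtain rfl := associated_iff_eq.mp hj
  have hP1 : 1 < Ideal.absNorm P :=
    HeightOneSpectrum.one_lt_absNorm ⟨P, Ideal.isPrime_of_prime hP, hP.ne_zero⟩
  rw [map_pow] at hI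
  rw [Nat.pow_right_injective hP1 (hI.trans (pow_one _).symm), pow_one]

theorem exists_prime_exists_mul_eq_span_of_finrank_eq_two (hquad : Module.finrank ℚ K = 2)
    (hP : Prime P) :
    ∃ p : ℕ, p.Prime ∧ ∃ Q : Ideal (𝓞 K), P * Q = Ideal.span {(p : 𝓞 K)} ∧
      (Ideal.absNorm P = p ∧ Ideal.absNorm Q = p ∨ Q = 1) := by
  have hmax : P.IsMaximal := (Ideal.isPrime_of_prime hP).isMaximal hP.ne_zero
  obtain ⟨p, n, hn, hmem, hp, hPN⟩ := Ideal.exists_prime_and_absNorm_eq_pow P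
  obtain ⟨Q, hQ⟩ := Ideal.dvd_span_singleton.mpr hmem
  have hmul : Ideal.absNorm P * Ideal.absNorm Q = p ^ 2 := by
    rw [← map_mul, ← hQ, Ideal.absNorm_span_natCast, RingOfIntegers.rank, hquad]
  have hn2 : n ≤ 2 := (Nat.pow_dvd_pow_iff_le_right hp.one_lt).mp (hPN ▸ Dvd.intro _ hmul)
  refine ⟨p, hp, Q, hQ.symm, ?_⟩
  interval_cases n
  · rw [pow_one] at hPN
    rw [hPN, pow_two] at hmul
    exact Or.inl ⟨hPN, mul_left_cancel₀ hp.ne_zero hmul⟩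
  · rw [hPN] at hmul
    rw [Ideal.one_eq_top, ← Ideal.absNorm_eq_one_iff]
    exact Or.inr (mul_left_cancel₀ (pow_ne_zero 2 hp.ne_zero) (hmul.trans (mul_one _).symm))

end IdealsOfPrimePowerNorm

namespace AlgebraicHeckeCharacter

section ThetaCoefficients

open Finset.HasAntidiagonal

variable {K : Type*} [Field K] [NumberField K] {ι : K →+* ℂ} {𝔪 : Ideal (𝓞 K)} {k : ℕ}
  (ϱ : AlgebraicHeckeCharacter ι 𝔪 k) {P Q : Ideal (𝓞 K)} {p : ℕ}

theorem sum_onIdeal_mem_coeffField {β : Type*} {n : ℕ} {s : Finset β} {f : β → Ideal (𝓞 K)}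
    (hf : Set.InjOn f s) (hs : ∀ I, Ideal.absNorm I = n ↔ ∃ b ∈ s, f b = I) :
    ∑ b ∈ s, ϱ.onIdeal (f b) ∈ ϱ.coeffField := by
  classical
  refine IntermediateField.subset_adjoin ℚ _ ⟨n, ?_⟩
  have hset : (Ideal.finite_setOfPred_absNorm_eq (S := 𝓞 K) n).toFinset = s.image f := by
    ext I
    rw [Set.Finite.mem_toFinset, Finset.mem_image, ← hs]
    rfl
  simp only [theta, PowerSeries.coeff_mk]
  rw [hset, Finset.sum_image hf]

theorem onIdeal_mem_coeffField_of_unique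
    (hP : ∀ I : Ideal (𝓞 K), Ideal.absNorm I = Ideal.absNorm P → I = P) :
    ϱ.onIdeal P ∈ ϱ.coeffField := by
  have hsum := ϱ.sum_onIdeal_mem_coeffField (n := Ideal.absNorm P) (s := {P}) (f := id)
    Function.injective_id.injOn fun I => by
      simp only [Finset.mem_singleton, id_eq, exists_eq_left]
      exact ⟨fun h => (hP I h).symm, fun h => h ▸ rfl⟩
  rwa [Finset.sum_singleton] at hsum

theorem sum_antidiagonal_onIdeal_mem_coeffField (hp : p.Prime)
    (hPQ : P * Q = Ideal.span {(p : 𝓞 K)}) (hP : Ideal.absNorm P = p)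
    (hQ : Ideal.absNorm Q = p) (hne : P ≠ Q) (n : ℕ) :
    ∑ e ∈ antidiagonal n, ϱ.onIdeal P ^ e.1 * ϱ.onIdeal Q ^ e.2 ∈ ϱ.coeffField := by
  have hinj : Set.InjOn (fun e : ℕ × ℕ => P ^ e.1 * Q ^ e.2) (antidiagonal n) :=
    fun e he e' he' heq => (antidiagonal_congr he he').mpr <|
      exponent_eq_of_pow_mul_pow_eq (prime_of_absNorm_eq_prime hp hP)
        (not_dvd_of_absNorm_eq_prime hp hP hQ hne) heq
  have hsum := ϱ.sum_onIdeal_mem_coeffField hinj fun I =>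
    absNorm_eq_pow_iff_of_mul_eq_span hp hPQ hP hQ n
  simpa only [onIdeal_mul, onIdeal_pow] using hsum

theorem add_mem_mul_mem_coeffField_of_mul_eq_span (hp : p.Prime)
    (hPQ : P * Q = Ideal.span {(p : 𝓞 K)}) (hP : Ideal.absNorm P = p)
    (hQ : Ideal.absNorm Q = p) (hne : P ≠ Q) :
    ϱ.onIdeal P + ϱ.onIdeal Q ∈ ϱ.coeffField ∧ ϱ.onIdeal P * ϱ.onIdeal Q ∈ ϱ.coeffField := by
  set x := ϱ.onIdeal P
  set y := ϱ.onIdeal Q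
  have hsum : ∀ n, ∑ e ∈ antidiagonal n, x ^ e.1 * y ^ e.2 ∈ ϱ.coeffField :=
    ϱ.sum_antidiagonal_onIdeal_mem_coeffField hp hPQ hP hQ hne
  have hadd : x + y ∈ ϱ.coeffField := by
    convert! hsum 1 using 1
    simp [Finset.Nat.antidiagonal_succ, add_comm]
  have hsq : x ^ 2 + x * y + y ^ 2 ∈ ϱ.coeffField := by
    convert! hsum 2 using 1
    simp [Finset.Nat.antidiagonal_succ, add_comm]
  refine ⟨hadd, ?_⟩
  rw [show x * y = (x + y) ^ 2 - (x ^ 2 + x * y + y ^ 2) by ring]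
  exact sub_mem (pow_mem hadd 2) hsq

theorem exists_add_mem_mul_mem_coeffField (hquad : Module.finrank ℚ K = 2) (hP : Prime P) :
    ∃ y ∈ ϱ.valueField, ϱ.onIdeal P + y ∈ ϱ.coeffField ∧ ϱ.onIdeal P * y ∈ ϱ.coeffField := by
  have hself : (∀ I : Ideal (𝓞 K), Ideal.absNorm I = Ideal.absNorm P → I = P) →
      ∃ y ∈ ϱ.valueField, ϱ.onIdeal P + y ∈ ϱ.coeffField ∧ ϱ.onIdeal P * y ∈ ϱ.coeffField :=
    fun h => ⟨0, zero_mem _, by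
      rw [add_zero, mul_zero]
      exact ⟨ϱ.onIdeal_mem_coeffField_of_unique h, zero_mem _⟩⟩
  obtain ⟨p, hp, Q, hPQ, ⟨hPN, hQN⟩ | rfl⟩ :=
    exists_prime_exists_mul_eq_span_of_finrank_eq_two hquad hP
  · rcases eq_or_ne P Q with rfl | hne
    · refine hself fun I hI => ?_
      obtain ⟨e, he, rfl⟩ := (absNorm_eq_pow_iff_of_mul_eq_span hp hPQ hPN hQN 1).mp
        (hI.trans (hPN.trans (pow_one p).symm))
      rw [← pow_add, mem_antidiagonal.mp he, pow_one]
    · exact ⟨ϱ.onIdeal Q, ϱ.onIdeal_mem_valueField Q,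
        ϱ.add_mem_mul_mem_coeffField_of_mul_eq_span hp hPQ hPN hQN hne⟩
  · exact hself fun I => eq_of_absNorm_eq_of_span_natCast_eq hP (by rw [← hPQ, mul_one])

end ThetaCoefficients

end AlgebraicHeckeCharacter

end CMTheta

theorem mainTheorem9 {K : Type*} [Field K] [NumberField K]
    (hquad : Module.finrank ℚ K = 2) (him : NumberField.IsTotallyComplex K) (ι : K →+* ℂ)
    (𝔪 : Ideal (NumberField.RingOfIntegers K)) (h𝔪 : 𝔪 ≠ ⊥) (k : ℕ) (hk : 1 ≤ k)
    (ϱ : CMTheta.AlgebraicHeckeCharacter ι 𝔪 k) :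
    (IsGalois ϱ.coeffField ϱ.valueFieldOver ∧
      FiniteDimensional ϱ.coeffField ϱ.valueFieldOver ∧
      CMTheta.IsElementaryAbelianTwoGroup (ϱ.valueFieldOver ≃ₐ[ϱ.coeffField] ϱ.valueFieldOver)) ∧
    CMTheta.IsKroneckerian ϱ.valueField := by
  have hquadratic : ∀ x ∈ ϱ.onIdeal '' {P | Prime P}, ∃ y ∈ ϱ.valueFieldOver,
      ∃ s t : ϱ.coeffField, x + y = algebraMap _ ℂ s ∧ x * y = algebraMap _ ℂ t := by
    rintro _ ⟨P, hP, rfl⟩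
    obtain ⟨y, hy, hs, ht⟩ := ϱ.exists_add_mem_mul_mem_coeffField hquad hP
    exact ⟨y, hy, ⟨_, hs⟩, ⟨_, ht⟩, rfl, rfl⟩
  have hgen := ϱ.valueFieldOver_eq_adjoin
  have : Normal ϱ.coeffField ϱ.valueFieldOver :=
    CMTheta.normal_of_eq_adjoin_of_forall_exists_add_mul hgen hquadratic
  have : FiniteDimensional ℚ ϱ.valueFieldOver :=
    (ϱ.numberField_valueField h𝔪).to_finiteDimensional
  exact ⟨⟨⟨⟩, FiniteDimensional.right ℚ ϱ.coeffField ϱ.valueFieldOver,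
    CMTheta.isElementaryAbelianTwoGroup_algEquiv_of_eq_adjoin hgen hquadratic⟩,
    ϱ.isKroneckerian_valueField hquad h𝔪⟩
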